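/- Let $\kappa$ be an infinite cardinal. Write $\mathfrak d$ for the dominating number, i.e. the least cardinality of a family $F\subseteq{}^{\omega}\omega$ such that every $g\in{}^{\omega}\omega$ satisfies $g(n)\le f(n)$ for all but finitely many $n$, for some $f\in F$. "Space" means a $T_1$ topological space without isolated points. For a space $X$ and $A\subseteq X$ let $cl_\theta(A)$ be the set of all $x\in X$ such that $\overline U\cap A\neq\emptyset$ for every neighborhood $U$ of $x$; $A$ is $\theta$-dense if $cl_\theta(A)=X$, and $\mathcal D_\theta$ is the family of all $\theta$-dense subsets of $X$. A $\theta$-$\pi$-base of $X$ is a family $\mathcal V$ of nonempty open sets such that for every nonempty open $U\subseteq X$ there is $V\in\mathcal V$ with $V\subseteq\overline U$; $\pi_\theta(X)$ is the least cardinality of a $\theta$-$\pi$-base of $X$. $\delta_\theta(X)$ is the least infinite cardinal $\lambda$ such that every $\theta$-dense $D\subseteq X$ contains a $\theta$-dense $C\subseteq D$ with $|C|\le\lambda$. The selection principle $\mathsf S_{fin}(\mathcal D_\theta,\mathcal D_\theta)$ states that for every sequence $(D_n)_{n<\omega}$ of $\theta$-dense sets there are finite sets $F_n\subseteq D_n$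 such that $\bigcup_{n<\omega}F_n$ is $\theta$-dense. In the game $\mathsf G_{fin}(\mathcal D_\theta,\mathcal D_\theta)$ players ONE and TWO play an inning for each $n<\omega$: in inning $n$ ONE chooses a $\theta$-dense set $O_n$ and TWO responds with a finite set $T_n\subseteq O_n$. TWO wins the play if $\bigcup_{n<\omega}T_n$ is $\theta$-dense; otherwise ONE wins. **Theorem.** The following statements are equivalent: 1. $\kappa<\mathfrak d$. 2. For every space $X$ with $\delta_\theta(X)=\aleph_0$ and $\pi_\theta(X)\le\kappa$, ONE has no winning strategy in the game $\mathsf G_{fin}(\mathcal D_\theta,\mathcal D_\theta)$ on $X$. 3. For every space $X$ with $\delta_\theta(X)=\aleph_0$ and $\pi_\theta(X)\le\kappa$, the selection principle $\mathsf S_{fin}(\mathcal D_\theta,\mathcal D_\theta)$ holds for $X$. -/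

import Mathlib

open Cardinal Topology Filter

universe u

namespace ThetaSelection

/-- The dominating number `𝔡`: the least cardinality of a family `F` of functions `ℕ → ℕ` such that
every `g : ℕ → ℕ` is eventually bounded by some member of `F`. -/
noncomputable def dominatingNumber : Cardinal.{0} :=
  sInf {c | ∃ F : Set (ℕ → ℕ), (∀ g : ℕ → ℕ, ∃ f ∈ F, ∀ᶠ n in atTop, g n ≤ f n) ∧ #F = c}

section Spaces

variable (X : Type u) [TopologicalSpace X]

/-- The `θ`-closure of `A`: the points all of whose neighbourhoods have closures that meet `A`. -/
def thetaClosure {X : Type u} [TopologicalSpace X] (A : Set X) : Set X :=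
  {x | ∀ U ∈ 𝓝 x, (closure U ∩ A).Nonempty}

/-- The family `D_θ` of all `θ`-dense subsets of `X`. -/
def thetaDense : Set (Set X) :=
  {D | thetaClosure D = Set.univ}

/-- A `θ`-`π`-base: a family of nonempty open sets such that the closure of every nonempty open set
contains a member of the family. -/
def IsThetaPiBase {X : Type u} [TopologicalSpace X] (V : Set (Set X)) : Prop :=
  (∀ W ∈ V, IsOpen W ∧ W.Nonempty) ∧
    ∀ U : Set X, IsOpen U → U.Nonempty → ∃ W ∈ V, W ⊆ closure U

/-- `π_θ(X)`, the least cardinality of a `θ`-`π`-base. -/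
noncomputable def thetaPiWeight : Cardinal.{u} :=
  sInf {c | ∃ V : Set (Set X), IsThetaPiBase V ∧ #V = c}

/-- `δ_θ(X)`, the least infinite cardinal `c` such that every `θ`-dense set contains a `θ`-dense
set of cardinality at most `c`. -/
noncomputable def thetaDelta : Cardinal.{u} :=
  sInf {c | ℵ₀ ≤ c ∧ ∀ D ∈ thetaDense X, ∃ C ⊆ D, C ∈ thetaDense X ∧ #C ≤ c}

/-- The minimum defining `π_θ` is over a nonempty set. -/
theorem thetaPiWeight_nonempty :
    {c : Cardinal.{u} | ∃ V : Set (Set X), IsThetaPiBase V ∧ #V = c}.Nonempty :=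
  ⟨_, {W | IsOpen W ∧ W.Nonempty}, ⟨fun _ h => h, fun U hU hne => ⟨U, ⟨hU, hne⟩, subset_closure⟩⟩,
    rfl⟩

/-- The minimum defining `δ_θ` is over a nonempty set. -/
theorem thetaDelta_nonempty :
    {c : Cardinal.{u} | ℵ₀ ≤ c ∧
      ∀ D ∈ thetaDense X, ∃ C ⊆ D, C ∈ thetaDense X ∧ #C ≤ c}.Nonempty :=
  ⟨max ℵ₀ #X, le_max_left _ _, fun D hD =>
    ⟨D, subset_rfl, hD, (Cardinal.mk_set_le D).trans (le_max_right _ _)⟩⟩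

end Spaces

/-- The selection principle `S_fin(𝒜, ℬ)`. -/
def SFin {X : Type u} (𝒜 ℬ : Set (Set X)) : Prop :=
  ∀ A : ℕ → Set X, (∀ n, A n ∈ 𝒜) →
    ∃ B : ℕ → Finset X, (∀ n, (B n : Set X) ⊆ A n) ∧ (⋃ n, (B n : Set X)) ∈ ℬ

/-- A strategy for ONE in `G_fin(𝒜, ℬ)`: it sends the list of the moves that TWO has made so far,
in chronological order, to ONE's next move, a member of `𝒜`. -/
abbrev StrategyOne {X : Type u} (𝒜 : Set (Set X)) : Type u :=
  List (Finset X) → {A : Set X // A ∈ 𝒜}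

/-- ONE's move in inning `n` when ONE follows `σ` and TWO's moves are `T 0, T 1, …`. -/
def StrategyOne.move {X : Type u} {𝒜 : Set (Set X)} (σ : StrategyOne 𝒜) (T : ℕ → Finset X)
    (n : ℕ) : Set X :=
  (σ ((List.range n).map T)).1

/-- The strategy `σ` is winning for ONE in `G_fin(𝒜, ℬ)`: ONE wins every play in which ONE follows
`σ` and TWO obeys the rules, that is, chooses in each inning a finite subset of ONE's move. -/
def StrategyOne.IsWinning {X : Type u} {𝒜 : Set (Set X)} (σ : StrategyOne 𝒜)
    (ℬ : Set (Set X)) : Prop :=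
  ∀ T : ℕ → Finset X, (∀ n, (T n : Set X) ⊆ σ.move T n) → (⋃ n, (T n : Set X)) ∉ ℬ

/-- ONE has a winning strategy in the game `G_fin(𝒜, ℬ)`. -/
def OneWinsGFin {X : Type u} (𝒜 ℬ : Set (Set X)) : Prop :=
  ∃ σ : StrategyOne 𝒜, σ.IsWinning ℬ

end ThetaSelection

open ThetaSelection

/-!
The implication from the game to the selection principle is immediate, since ONE may ignore TWO.

**From `κ < 𝔡` to the game.** Since `δ_θ(X) = ℵ₀`, every `θ`-dense set `D` contains an increasing
sequence of finite sets with `θ`-dense union (`exists_finset_exhaustion`). Let TWO answer only with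
members of these sequences, so that a play against a fixed strategy of ONE is coded by a function
`f : ℕ → ℕ`. A set is `θ`-dense as soon as it meets the closure of every member `V` of a
`θ`-`π`-base. For a fixed `V`, the functions `f` coding a play in which TWO never meets `closure V`
are the branches of a finitely branching tree, hence are all bounded by a single function `g_V`.
If there are fewer than `𝔡` sets `V`, some `f` is not dominated by any `g_V`
(`exists_forall_exists_le`), and the play that it codes is won by TWO.

**From the selection principle to `κ < 𝔡`.** If `𝔡 ≤ κ`, let `F` be a family of at most `κ`
functions that bounds every function everywhere. The countable space `ColumnSpace F` consists of the
triples `(n, m, P)` with `P` a finite set of finite sequences. For `f ∈ F` the set `above f` of the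
triples with `f n < m` and `f ↾ m ∈ P` is declared clopen, and every cofinite
set is declared open.
The sets `above f` are independent on each column `{n} × ℕ × _` (`ColumnSpace.exists_mem_column`), so
every column is dense. If a finite subset is selected from each column, then some `f ∈ F` bounds all
of them, and `above f` is a nonempty clopen set that misses the selection.
-/

namespace ThetaSelection

/-! ### The dominating number -/

theorem exists_dominating_family :
    ∃ F : Set (ℕ → ℕ), (∀ g : ℕ → ℕ, ∃ f ∈ F, ∀ᶠ n in atTop, g n ≤ f n) ∧
      #F = dominatingNumber :=
  csInf_mem (s := {c | ∃ F : Set (ℕ → ℕ),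
    (∀ g : ℕ → ℕ, ∃ f ∈ F, ∀ᶠ n in atTop, g n ≤ f n) ∧ #F = c})
    ⟨_, Set.univ, fun g => ⟨g, trivial, Eventually.of_forall fun _ => le_rfl⟩, rfl⟩

/-- Fewer than `𝔡` functions do not form a dominating family. -/
theorem exists_not_dominated {ι : Type u} (hι : #ι < Cardinal.lift.{u} dominatingNumber)
    (g : ι → ℕ → ℕ) : ∃ f : ℕ → ℕ, ∀ i, ∃ n, g i n < f n := by
  by_contra! h
  have h1 : dominatingNumber ≤ #(Set.range g) := by
    refine csInf_le' ⟨Set.range g, fun f => ?_, rfl⟩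
    obtain ⟨i, hi⟩ := h f
    exact ⟨g i, ⟨i, rfl⟩, Eventually.of_forall hi⟩
  have h2 := (Cardinal.lift_le.{u}.2 h1).trans (Cardinal.mk_range_le_lift (f := g))
  rw [Cardinal.lift_id'] at h2
  exact absurd hι (not_lt.2 (by simpa using h2))

/-- The values along the branches of a finitely branching tree are bounded by a single function. -/
theorem exists_bound_of_forall_lt (k : List ℕ → ℕ) :
    ∃ g : ℕ → ℕ, ∀ f : ℕ → ℕ, (∀ n, f n < k ((List.range n).map f)) → ∀ n, f n ≤ g n := by
  -- `S n` is the `n`-th level of the tree.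
  let S : ℕ → Finset (List ℕ) := fun n => Nat.rec {[]}
    (fun _ A => A.biUnion fun s => (Finset.range (k s)).image fun j => s ++ [j]) n
  refine ⟨fun n => (S n).sup k, fun f hf n => ?_⟩
  have hS : ∀ n, (List.range n).map f ∈ S n := by
    intro n
    induction n with
    | zero => simp [S]
    | succ n ih =>
      refine Finset.mem_biUnion.2 ⟨_, ih, Finset.mem_image.2 ⟨f n, Finset.mem_range.2 (hf n), ?_⟩⟩
      simp [List.range_succ]
  exact (hf n).le.trans (Finset.le_sup (f := k) (hS n))

/-- For fewer than `𝔡` prediction functions on finite sequences, some `f : ℕ → ℕ` exceeds each of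
them at least once along its initial segments. -/
theorem exists_forall_exists_le {ι : Type u} (hι : #ι < Cardinal.lift.{u} dominatingNumber)
    (k : ι → List ℕ → ℕ) :
    ∃ f : ℕ → ℕ, ∀ i, ∃ n, k i ((List.range n).map f) ≤ f n := by
  choose g hg using fun i => exists_bound_of_forall_lt (k i)
  obtain ⟨f, hf⟩ := exists_not_dominated hι g
  refine ⟨f, fun i => ?_⟩
  by_contra! h
  obtain ⟨n, hn⟩ := hf i
  exact absurd (hg i f h n) (not_le.2 hn)

/-- From a family dominating every function eventually one obtains a family bounding every function
everywhere by taking maxima with constants. -/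
theorem exists_everywhere_dominating_family {κ : Cardinal.{u}} (hκ : ℵ₀ ≤ κ)
    (h : Cardinal.lift.{u} dominatingNumber ≤ κ) :
    ∃ F : Set (ℕ → ℕ), (∀ g : ℕ → ℕ, ∃ f ∈ F, ∀ n, g n ≤ f n) ∧ Cardinal.lift.{u} #F ≤ κ := by
  obtain ⟨F, hF, hc⟩ := exists_dominating_family
  refine ⟨Set.range fun p : F × ℕ => fun n => max (p.1.1 n) p.2, fun g => ?_, ?_⟩
  · obtain ⟨f, hf, hgf⟩ := hF g
    obtain ⟨N, hN⟩ := eventually_atTop.1 hgf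
    refine ⟨_, ⟨(⟨f, hf⟩, (Finset.range N).sup g), rfl⟩, fun n => ?_⟩
    rcases lt_or_ge n N with hn | hn
    · exact le_max_of_le_right (Finset.le_sup (Finset.mem_range.2 hn))
    · exact le_max_of_le_left (hN n hn)
  · refine (Cardinal.lift_le.2 Cardinal.mk_range_le).trans ?_
    rw [Cardinal.mk_prod, Cardinal.lift_id, Cardinal.lift_id, hc, Cardinal.lift_mul]
    exact Cardinal.mul_le_of_le hκ h (by simpa using hκ)

/-! ### `θ`-dense sets -/

section ThetaDense

variable {X : Type u} [TopologicalSpace X]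

theorem mem_thetaDense_iff {D : Set X} :
    D ∈ thetaDense X ↔ ∀ U : Set X, IsOpen U → U.Nonempty → (closure U ∩ D).Nonempty := by
  constructor
  · rintro h U hU ⟨x, hx⟩
    have hxD : x ∈ thetaClosure D := (show thetaClosure D = Set.univ from h) ▸ Set.mem_univ x
    exact hxD U (hU.mem_nhds hx)
  · refine fun h => Set.eq_univ_of_forall fun x U hU => ?_
    obtain ⟨W, hWU, hW, hx⟩ := mem_nhds_iff.1 hU
    exact (h W hW ⟨x, hx⟩).mono (Set.inter_subset_inter_left _ (closure_mono hWU))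

/-- `θ`-density may be tested on the members of a `θ`-`π`-base. -/
theorem IsThetaPiBase.mem_thetaDense {V : Set (Set X)} (hV : IsThetaPiBase V) {D : Set X}
    (h : ∀ W ∈ V, (closure W ∩ D).Nonempty) : D ∈ thetaDense X := by
  refine mem_thetaDense_iff.2 fun U hU hne => ?_
  obtain ⟨W, hW, hWU⟩ := hV.2 U hU hne
  exact (h W hW).mono (Set.inter_subset_inter_left _ (closure_minimal hWU isClosed_closure))

/-- If `δ_θ(X) = ℵ₀`, then every `θ`-dense set contains an increasing sequence of finite sets with
`θ`-dense union. -/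
theorem exists_finset_exhaustion (hδ : thetaDelta X = ℵ₀) {D : Set X} (hD : D ∈ thetaDense X) :
    ∃ s : ℕ → Finset X, Monotone s ∧ (∀ k, (s k : Set X) ⊆ D) ∧
      (⋃ k, (s k : Set X)) ∈ thetaDense X := by
  have hmem := csInf_mem (thetaDelta_nonempty X)
  obtain ⟨C, hCD, hC, hcard⟩ := hmem.2 D hD
  change #C ≤ thetaDelta X at hcard
  rw [hδ, Cardinal.le_aleph0_iff_set_countable] at hcard
  obtain ⟨e, he⟩ := Set.countable_iff_exists_injOn.1 hcard
  have hfin : ∀ k, (C ∩ e ⁻¹' Set.Iic k).Finite := fun k =>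
    Set.Finite.of_finite_image ((Set.finite_Iic k).subset (by rintro _ ⟨x, hx, rfl⟩; exact hx.2))
      (he.mono Set.inter_subset_left)
  refine ⟨fun k => (hfin k).toFinset, fun k l hkl => ?_, fun k => ?_, ?_⟩
  · exact Set.Finite.toFinset_mono fun x hx => ⟨hx.1, le_trans hx.2 hkl⟩
  · simpa using Set.inter_subset_left.trans hCD
  · convert hC
    ext x
    simp only [Set.Finite.coe_toFinset, Set.mem_iUnion]
    exact ⟨fun ⟨_, h⟩ => h.1, fun h => ⟨e x, h, le_refl (e x)⟩⟩

end ThetaDense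

/-! ### The game below the dominating number -/

theorem not_oneWinsGFin_of_lt {X : Type u} [TopologicalSpace X] (hδ : thetaDelta X = ℵ₀)
    (hπ : thetaPiWeight X < Cardinal.lift.{u} dominatingNumber) :
    ¬ OneWinsGFin (thetaDense X) (thetaDense X) := by
  rintro ⟨σ, hσ⟩
  obtain ⟨V, hV, hVc⟩ := csInf_mem (thetaPiWeight_nonempty X)
  choose seg hmono hsub hdense using
    fun D : {A : Set X // A ∈ thetaDense X} => exists_finset_exhaustion hδ D.2
  -- `pos s` is the list of TWO's moves when they are coded by the finite sequence `s`.
  let pos : List ℕ → List (Finset X) := fun s => s.foldl (fun h j => h ++ [seg (σ h) j]) []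
  have hk : ∀ (W : V) (s : List ℕ), ∃ k, (closure W.1 ∩ (seg (σ (pos s)) k : Set X)).Nonempty := by
    intro W s
    obtain ⟨hWo, hWn⟩ := hV.1 W.1 W.2
    obtain ⟨x, hx, hxs⟩ := mem_thetaDense_iff.1 (hdense (σ (pos s))) W.1 hWo hWn
    obtain ⟨k, hk⟩ := Set.mem_iUnion.1 hxs
    exact ⟨k, x, hx, hk⟩
  choose k hk using hk
  obtain ⟨f, hf⟩ := exists_forall_exists_le (ι := V) (hVc ▸ hπ) k
  let T : ℕ → Finset X := fun n => seg (σ (pos ((List.range n).map f))) (f n)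
  have hT : ∀ n, (List.range n).map T = pos ((List.range n).map f) := by
    intro n
    induction n with
    | zero => simp [pos]
    | succ n ih =>
      rw [List.range_succ, List.map_append, ih]
      simp [pos, T]
  refine hσ T (fun n => ?_) (hV.mem_thetaDense fun W hW => ?_)
  · rw [StrategyOne.move, hT]
    exact hsub _ _
  · obtain ⟨n, hn⟩ := hf ⟨W, hW⟩
    obtain ⟨x, hx, hxs⟩ := hk ⟨W, hW⟩ ((List.range n).map f)
    exact ⟨x, hx, Set.mem_iUnion.2 ⟨n, hmono _ hn hxs⟩⟩

/-- ONE may play a fixed sequence of sets, regardless of TWO's moves. -/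
theorem SFin.of_not_oneWinsGFin {X : Type u} {𝒜 ℬ : Set (Set X)} (h : ¬ OneWinsGFin 𝒜 ℬ) :
    SFin 𝒜 ℬ := by
  intro A hA
  by_contra! hB
  refine h ⟨fun l => ⟨A l.length, hA _⟩, fun T hT => hB T fun n => ?_⟩
  simpa [StrategyOne.move] using hT n

/-! ### A countable space without the selection principle -/

/-- The underlying set of the counterexample: the triples `(n, m, P)`, where `n` is the number of the
column and `P` is a finite set of finite sequences. The family `F` only enters the topology. -/
def ColumnSpace (_F : Set (ℕ → ℕ)) : Type u :=
  ULift.{u} (ℕ × ℕ × Finset (List ℕ))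

namespace ColumnSpace

variable {F : Set (ℕ → ℕ)}

instance : Countable (ColumnSpace.{u} F) :=
  inferInstanceAs (Countable (ULift.{u} (ℕ × ℕ × Finset (List ℕ))))

/-- The number of the column that contains `x`. -/
def col (x : ColumnSpace.{u} F) : ℕ := x.down.1

/-- The height of `x` in its column. -/
def height (x : ColumnSpace.{u} F) : ℕ := x.down.2.1

/-- The points that lie above the graph of `f` and whose finite set of sequences contains the
restriction of `f` to the height of the point. -/
def above (F : Set (ℕ → ℕ)) (f : ℕ → ℕ) : Set (ColumnSpace.{u} F) :=
  {x | f x.col < x.height ∧ (List.range x.height).map f ∈ x.down.2.2}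

/-- The basic neighbourhood of `x` (provided that `x ∉ B`): the points outside the finite set `B` that
belong to the same sets `above f` as `x` does, for `f` in the finite set `E`. -/
def basic (x : ColumnSpace.{u} F) (E : Finset F) (B : Finset (ColumnSpace.{u} F)) :
    Set (ColumnSpace.{u} F) :=
  {y | y ∉ B ∧ ∀ f ∈ E, y ∈ above F f.1 ↔ x ∈ above F f.1}

/-- The topology generated by the sets `above f` for `f ∈ F`, their complements, and the cofinite
sets. -/
instance : TopologicalSpace (ColumnSpace.{u} F) where
  IsOpen U := ∀ x ∈ U, ∃ E B, basic x E B ⊆ U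
  isOpen_univ _ _ := ⟨∅, ∅, Set.subset_univ _⟩
  isOpen_inter U W hU hW x hx := by
    classical
    obtain ⟨E, B, h⟩ := hU x hx.1
    obtain ⟨E', B', h'⟩ := hW x hx.2
    refine ⟨E ∪ E', B ∪ B', fun y hy => ⟨h ⟨?_, ?_⟩, h' ⟨?_, ?_⟩⟩⟩
    · exact fun hB => hy.1 (Finset.mem_union_left _ hB)
    · exact fun f hf => hy.2 f (Finset.mem_union_left _ hf)
    · exact fun hB => hy.1 (Finset.mem_union_right _ hB)
    · exact fun f hf => hy.2 f (Finset.mem_union_right _ hf)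
  isOpen_sUnion S hS x := by
    rintro ⟨U, hU, hx⟩
    obtain ⟨E, B, h⟩ := hS U hU x hx
    exact ⟨E, B, h.trans (Set.subset_sUnion_of_mem hU)⟩

theorem isOpen_iff {U : Set (ColumnSpace.{u} F)} :
    IsOpen U ↔ ∀ x ∈ U, ∃ E B, basic x E B ⊆ U :=
  Iff.rfl

theorem isOpen_basic (x : ColumnSpace.{u} F) (E : Finset F) (B : Finset (ColumnSpace.{u} F)) :
    IsOpen (basic x E B) :=
  isOpen_iff.2 fun _ hy => ⟨E, B, fun _ hz => ⟨hz.1, fun f hf => (hz.2 f hf).trans (hy.2 f hf)⟩⟩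

theorem isClopen_above {f : ℕ → ℕ} (hf : f ∈ F) : IsClopen (above.{u} F f) := by
  refine ⟨⟨isOpen_iff.2 fun x hx => ⟨{⟨f, hf⟩}, ∅, fun y hy => ?_⟩⟩,
    isOpen_iff.2 fun x hx => ⟨{⟨f, hf⟩}, ∅, fun y hy => ?_⟩⟩
  · exact fun h => hx ((hy.2 ⟨f, hf⟩ (Finset.mem_singleton_self _)).1 h)
  · exact (hy.2 ⟨f, hf⟩ (Finset.mem_singleton_self _)).2 hx

instance : T1Space (ColumnSpace.{u} F) where
  t1 x := ⟨isOpen_iff.2 fun _ _ => ⟨∅, {x}, fun _ hz h => hz.1 (Finset.mem_singleton.2 h)⟩⟩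

/-- Distinct members of a finite set of functions have distinct restrictions to every large enough
initial segment of `ℕ`. -/
theorem eventually_injOn_restrict (E : Finset F) :
    ∀ᶠ m in atTop, ∀ f ∈ E, ∀ g ∈ E, (List.range m).map f.1 = (List.range m).map g.1 → f = g := by
  simp only [Filter.eventually_all_finset]
  intro f _ g _
  by_cases h : f = g
  · exact Eventually.of_forall fun _ _ => h
  · obtain ⟨i, hi⟩ := Function.ne_iff.1 fun h' => h (Subtype.ext h')
    filter_upwards [eventually_gt_atTop i] with m hm heq
    exact absurd (List.map_inj_left.1 heq i (List.mem_range.2 hm)) hi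

/-- The sets `above f` with `f ∈ F` are independent on every column, modulo finite sets. -/
theorem exists_mem_column (n : ℕ) (E E' : Finset F) (hE' : E' ⊆ E)
    (B : Finset (ColumnSpace.{u} F)) :
    ∃ y : ColumnSpace.{u} F, y.col = n ∧ y ∉ B ∧ ∀ f ∈ E, y ∈ above F f.1 ↔ f ∈ E' := by
  classical
  have h1 : ∀ᶠ m in atTop, ∀ f ∈ E, f.1 n < m :=
    (Filter.eventually_all_finset E).2 fun f _ => eventually_gt_atTop (f.1 n)
  obtain ⟨m, hm1, hm2, hm3⟩ := (h1.and ((eventually_injOn_restrict E).and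
    (eventually_gt_atTop (B.sup height)))).exists
  refine ⟨⟨n, m, E'.image fun f => (List.range m).map f.1⟩, rfl, fun hB => ?_, fun f hf => ?_⟩
  · exact absurd (Finset.le_sup (f := height) hB) (not_le.2 hm3)
  · refine ⟨fun h => ?_, fun h => ⟨hm1 f hf, Finset.mem_image_of_mem _ h⟩⟩
    obtain ⟨g, hg, hgf⟩ := Finset.mem_image.1 h.2
    exact hm2 g (hE' hg) f hf hgf ▸ hg

theorem exists_mem_basic (n : ℕ) (x : ColumnSpace.{u} F) (E : Finset F)
    (B : Finset (ColumnSpace.{u} F)) : ∃ y ∈ basic x E B, y.col = n := by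
  classical
  obtain ⟨y, hy, hyB, h⟩ := exists_mem_column n E (E.filter fun f => x ∈ above F f.1)
    (Finset.filter_subset _ _) B
  exact ⟨y, ⟨hyB, fun f hf => (h f hf).trans (by simp [hf])⟩, hy⟩

theorem not_isOpen_singleton (x : ColumnSpace.{u} F) : ¬ IsOpen ({x} : Set (ColumnSpace.{u} F)) := by
  classical
  intro h
  obtain ⟨E, B, hEB⟩ := isOpen_iff.1 h x rfl
  obtain ⟨y, hy, -⟩ := exists_mem_basic 0 x E (insert x B)
  exact hy.1 (Finset.mem_insert.2 (.inl (hEB ⟨fun hB => hy.1 (Finset.mem_insert_of_mem hB), hy.2⟩)))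

theorem column_mem_thetaDense (n : ℕ) : {x : ColumnSpace.{u} F | x.col = n} ∈ thetaDense _ := by
  refine mem_thetaDense_iff.2 fun U hU ⟨x, hx⟩ => ?_
  obtain ⟨E, B, h⟩ := isOpen_iff.1 hU x hx
  obtain ⟨y, hy, hyn⟩ := exists_mem_basic n x E B
  exact ⟨y, subset_closure (h hy), hyn⟩

theorem thetaDelta_eq : thetaDelta (ColumnSpace.{u} F) = ℵ₀ :=
  le_antisymm (csInf_le' ⟨le_rfl, fun D hD => ⟨D, subset_rfl, hD, Cardinal.mk_le_aleph0⟩⟩)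
    (csInf_mem (thetaDelta_nonempty _)).1

theorem thetaPiWeight_le {κ : Cardinal.{u}} (hκ : ℵ₀ ≤ κ) (hF : Cardinal.lift.{u} #F ≤ κ) :
    thetaPiWeight (ColumnSpace.{u} F) ≤ κ := by
  let N : ColumnSpace.{u} F × ULift.{u} (Finset F) × Finset (ColumnSpace.{u} F) →
    Set (ColumnSpace.{u} F) := fun p => basic p.1 p.2.1.down p.2.2
  have hN : IsThetaPiBase (Set.range N) := by
    refine ⟨?_, fun U hU ⟨x, hx⟩ => ?_⟩
    · rintro _ ⟨p, rfl⟩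
      obtain ⟨y, hy, -⟩ := exists_mem_basic 0 p.1 p.2.1.down p.2.2
      exact ⟨isOpen_basic _ _ _, y, hy⟩
    · obtain ⟨E, B, h⟩ := isOpen_iff.1 hU x hx
      exact ⟨_, ⟨(x, ⟨E⟩, B), rfl⟩, h.trans subset_closure⟩
  have hE : Cardinal.lift.{u} #(Finset F) ≤ κ := by
    cases finite_or_infinite F
    · exact (Cardinal.lift_le_aleph0.2 Cardinal.mk_le_aleph0).trans hκ
    · rwa [Cardinal.mk_finset_of_infinite]
  have hle : thetaPiWeight (ColumnSpace.{u} F) ≤ #(Set.range N) :=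
    csInf_le' ⟨Set.range N, hN, rfl⟩
  refine hle.trans (Cardinal.mk_range_le.trans ?_)
  simp only [Cardinal.mk_prod, Cardinal.lift_id, Cardinal.mk_uLift]
  exact Cardinal.mul_le_of_le hκ (Cardinal.mk_le_aleph0.trans hκ)
    (Cardinal.mul_le_of_le hκ hE (Cardinal.mk_le_aleph0.trans hκ))

/-- No finite selection from the columns is `θ`-dense when `F` bounds every function everywhere. -/
theorem not_sFin (hF : ∀ g : ℕ → ℕ, ∃ f ∈ F, ∀ n, g n ≤ f n) :
    ¬ SFin (thetaDense (ColumnSpace.{u} F)) (thetaDense (ColumnSpace.{u} F)) := by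
  intro h
  obtain ⟨B, hBn, hB⟩ := h (fun n => {x | x.col = n}) column_mem_thetaDense
  obtain ⟨f, hf, hBf⟩ := hF fun n => (B n).sup height
  have hne : (above.{u} F f).Nonempty := by
    obtain ⟨y, -, -, hy⟩ := exists_mem_column 0 {⟨f, hf⟩} {⟨f, hf⟩} subset_rfl ∅
    exact ⟨y, (hy ⟨f, hf⟩ (Finset.mem_singleton_self _)).2 (Finset.mem_singleton_self _)⟩
  have hclopen := isClopen_above.{u} hf
  obtain ⟨x, hx, hxB⟩ := mem_thetaDense_iff.1 hB _ hclopen.isOpen hne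
  rw [hclopen.isClosed.closure_eq] at hx
  obtain ⟨n, hn⟩ := Set.mem_iUnion.1 hxB
  have hxn : x.col = n := hBn n hn
  have hle : x.height ≤ f n := (Finset.le_sup (f := height) hn).trans (hBf n)
  exact absurd hx.1 (not_lt.2 (hxn ▸ hle))

end ColumnSpace

end ThetaSelection

open ThetaSelection
theorem mainTheorem2 (κ : Cardinal.{u}) (hκ : ℵ₀ ≤ κ) :
    List.TFAE [
      κ < Cardinal.lift.{u} dominatingNumber,
      ∀ (X : Type u) [TopologicalSpace X] [T1Space X], (∀ x : X, ¬ IsOpen ({x} : Set X)) →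
        thetaDelta X = ℵ₀ → thetaPiWeight X ≤ κ →
          ¬ OneWinsGFin (thetaDense X) (thetaDense X),
      ∀ (X : Type u) [TopologicalSpace X] [T1Space X], (∀ x : X, ¬ IsOpen ({x} : Set X)) →
        thetaDelta X = ℵ₀ → thetaPiWeight X ≤ κ →
          SFin (thetaDense X) (thetaDense X)] := by
  tfae_have 1 → 2 := fun h X _ _ _ hδ hπ => not_oneWinsGFin_of_lt hδ (hπ.trans_lt h)
  tfae_have 2 → 3 := fun h X _ _ hX hδ hπ => .of_not_oneWinsGFin (h X hX hδ hπ)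
  tfae_have 3 → 1 := by
    intro h
    by_contra! hd
    obtain ⟨F, hF, hFc⟩ := exists_everywhere_dominating_family hκ hd
    exact ColumnSpace.not_sFin hF (h (ColumnSpace.{u} F) ColumnSpace.not_isOpen_singleton
      ColumnSpace.thetaDelta_eq (ColumnSpace.thetaPiWeight_le hκ hFc))
  tfae_finish
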